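/- Let $H_B\in\mathbb{C}^{N_B\times N_A}$ and $H_E\in\mathbb{C}^{N_E\times N_A}$. For a positive semidefinite Hermitian matrix $K\in\mathbb{C}^{N_A\times N_A}$ let $K^{1/2}$ denote any square matrix $B$ with $BB^\dagger=K$, put $G(H,K)=\begin{pmatrix}HK^{1/2}\\ I\end{pmatrix}$, and let $\mu_1(H_B,H_E,K)\ge\dots\ge\mu_{N_A}(H_B,H_E,K)$ be the generalized singular values of the pair $(G_B,G_E)=(G(H_B,K),G(H_E,K))$ (formed with the same $K^{1/2}$), that is, the non-negative solutions $\mu$ of $\det(G_B^\dagger G_B-\mu^2G_E^\dagger G_E)=0$, counted with the algebraic multiplicity of $\mu^2$. Let $K$ and $\bar K$ satisfy $0\preceq K\preceq\bar K$, where $X\preceq Y$ means that $Y-X$ is positive semidefinite. Then, for every $i=1,\dots,N_A$ and for all choices of $K^{1/2}$ and $\bar K^{1/2}$, the numbers $\mu_i(H_B,H_E,K)$ and $\mu_i(H_B,H_E,\bar K)$ are positive and $$\bigl|\log\mu_i(H_B,H_E,\bar K)\bigr|\ \ge\ \bigl|\log\mu_i(H_B,H_E,K)\bigr| .$$ Moreover,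 passing from $\bar K$ to $K$ moves each generalized singular value towards $1$: if $\mu_i(H_B,H_E,\bar K)\ge1$ then $1\le\mu_i(H_B,H_E,K)\le\mu_i(H_B,H_E,\bar K)$, and if $\mu_i(H_B,H_E,\bar K)\le1$ then $\mu_i(H_B,H_E,\bar K)\le\mu_i(H_B,H_E,K)\le1$. -/

import Mathlib

open scoped Matrix ComplexOrder

noncomputable section

/-- The pencil determinant `det (A₁ᴴ A₁ - λ A₂ᴴ A₂)`, as a polynomial in the variable `λ = μ²`. -/
def gsvPoly {m₁ m₂ n : Type*} [Fintype m₁] [Fintype m₂] [Fintype n] [DecidableEq n]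
    (A₁ : Matrix m₁ n ℂ) (A₂ : Matrix m₂ n ℂ) : Polynomial ℂ :=
  ((A₁ᴴ * A₁).map Polynomial.C - (Polynomial.X : Polynomial ℂ) • (A₂ᴴ * A₂).map Polynomial.C).det

open scoped Classical in
/-- The generalized singular values of `(A₁, A₂)`: the non-negative solutions `μ` of
`det (A₁ᴴ A₁ - μ² A₂ᴴ A₂) = 0`, each taken with the multiplicity of `μ²` as a root of the pencil
determinant. (Used for pairs whose pencil determinant is not identically zero.) -/
def gsvMultiset {m₁ m₂ n : Type*} [Fintype m₁] [Fintype m₂] [Fintype n] [DecidableEq n]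
    (A₁ : Matrix m₁ n ℂ) (A₂ : Matrix m₂ n ℂ) : Multiset ℝ :=
  ((gsvPoly A₁ A₂).roots.filter (fun z : ℂ => z.im = 0 ∧ 0 ≤ z.re)).map (fun z => √z.re)

/-- The `i`-th entry (counted from `0`) of the GSV vector: the generalized singular values with
multiplicity, in non-increasing order. The default `0` is returned only past the end of the list of
generalized singular values, so a positive value is a genuine generalized singular value. -/
def gsv {m₁ m₂ n : Type*} [Fintype m₁] [Fintype m₂] [Fintype n] [DecidableEq n]
    (A₁ : Matrix m₁ n ℂ) (A₂ : Matrix m₂ n ℂ) (i : ℕ) : ℝ :=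
  ((gsvMultiset A₁ A₂).sort (· ≥ ·)).getD i 0

/-- `B` is an admissible choice of `K^{1/2}`: a square matrix with `B Bᴴ = K`. -/
def IsMatrixSqrt {n : Type*} [Fintype n] (B K : Matrix n n ℂ) : Prop :=
  B * Bᴴ = K

/-- The effective MMSE channel matrix: `H K^{1/2}` stacked on top of the identity matrix, where `B`
is the chosen `K^{1/2}`. -/
def effMMSE {m n : Type*} [Fintype n] [DecidableEq n]
    (H : Matrix m n ℂ) (B : Matrix n n ℂ) : Matrix (m ⊕ n) n ℂ :=
  Matrix.fromRows (H * B) 1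

/-- `μ_i(H_B, H_E, K)`: the `i`-th generalized singular value of the effective MMSE channel matrices
of the two channels, both formed with the same chosen `B = K^{1/2}`. -/
def channelGSV {mB mE n : Type*} [Fintype mB] [Fintype mE] [Fintype n] [DecidableEq n]
    (HB : Matrix mB n ℂ) (HE : Matrix mE n ℂ) (B : Matrix n n ℂ) (i : ℕ) : ℝ :=
  gsv (effMMSE HB B) (effMMSE HE B) i

end

open Matrix Polynomial

/-! Squared generalized singular values are the eigenvalues of a pencil of two positive definite
matrices, so they are governed by the forms `a‖G_B v‖² - b‖G_E v‖²`. With `G` as given this equals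
`a‖H_B B v‖² - b‖H_E B v‖² - (b - a)‖v‖²`. By Douglas' lemma `B = B' C` with `C` a contraction.
Passing from `(B, v)` to `(B', C v)` fixes the first two terms and, for `a < b`, does not decrease
the third, so nonnegativity survives (`channel_form_mono`). A dimension count
(`card_add_card_le_of_form`) turns this into eigenvalue comparison: `(a, b) = (1, λ)` handles `λ >
1`, and `(-1, -λ)` handles `λ < 1`. -/

/-- The squared Euclidean norm of a complex vector. -/
noncomputable def sqNorm {ι : Type*} [Fintype ι] (v : ι → ℂ) : ℝ := ∑ k, Complex.normSq (v k)

theorem ofReal_sqNorm {ι : Type*} [Fintype ι] (v : ι → ℂ) : (sqNorm v : ℂ) = star v ⬝ᵥ v := by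
  simp [sqNorm, dotProduct, Complex.normSq_eq_conj_mul_self]

theorem sqNorm_zero {ι : Type*} [Fintype ι] : sqNorm (0 : ι → ℂ) = 0 := by
  simp [sqNorm]

theorem sqNorm_pos {ι : Type*} [Fintype ι] {v : ι → ℂ} (hv : v ≠ 0) : 0 < sqNorm v := by
  obtain ⟨k, hk⟩ := Function.ne_iff.mp hv
  exact Finset.sum_pos' (fun j _ => Complex.normSq_nonneg _)
    ⟨k, Finset.mem_univ k, Complex.normSq_pos.mpr hk⟩

theorem sqNorm_eq_norm_sq {ι : Type*} [Fintype ι] (v : ι → ℂ) :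
    sqNorm v = ‖WithLp.toLp 2 v‖ ^ 2 := by
  simp [sqNorm, EuclideanSpace.norm_sq_eq, Complex.normSq_eq_norm_sq]

theorem ofReal_sqNorm_mulVec {ι κ : Type*} [Fintype ι] [Fintype κ] (A : Matrix ι κ ℂ)
    (v : κ → ℂ) : (sqNorm (A *ᵥ v) : ℂ) = star v ⬝ᵥ ((Aᴴ * A) *ᵥ v) := by
  rw [ofReal_sqNorm, star_mulVec, ← mulVec_mulVec, ← dotProduct_mulVec]

/-- If congruence by `P` diagonalizes `Aᴴ A`, the squared norm of `A P x` is a weighted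
sum of squares. -/
theorem sqNorm_mulVec_of_diagonal {ι κ : Type*} [Fintype ι] [Fintype κ] [DecidableEq κ]
    {A : Matrix ι κ ℂ} {P : Matrix κ κ ℂ} {d : κ → ℝ}
    (h : Pᴴ * (Aᴴ * A) * P = diagonal fun j => (d j : ℂ)) (x : κ → ℂ) :
    sqNorm (A *ᵥ (P *ᵥ x)) = ∑ j, d j * Complex.normSq (x j) := by
  have h1 : ((A * P)ᴴ * (A * P)) = diagonal fun j => (d j : ℂ) := by
    rw [← h, conjTranspose_mul]; simp only [Matrix.mul_assoc]
  apply Complex.ofReal_injective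
  rw [mulVec_mulVec, ofReal_sqNorm_mulVec, h1]
  simp only [dotProduct, mulVec_diagonal, Pi.star_apply, Complex.ofReal_sum, Complex.ofReal_mul,
    Complex.normSq_eq_conj_mul_self, RCLike.star_def]
  exact Finset.sum_congr rfl fun j _ => by ring

/-! ### Simultaneous diagonalization and generalized singular values -/

open scoped MatrixOrder Matrix.Norms.L2Operator in
theorem exists_simultaneous_diagonal {ι : Type*} [Fintype ι] [DecidableEq ι]
    {A S : Matrix ι ι ℂ} (hA : A.IsHermitian) (hS : S.PosDef) :
    ∃ (P : Matrix ι ι ℂ) (d : ι → ℝ),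
      Pᴴ * A * P = diagonal (fun j => (d j : ℂ)) ∧ Pᴴ * S * P = 1 := by
  obtain ⟨T, hT, hST⟩ := CStarAlgebra.isStrictlyPositive_iff_eq_star_mul_self.mp
    hS.isStrictlyPositive
  rw [star_eq_conjTranspose] at hST
  have hT' : IsUnit T.det := (isUnit_iff_isUnit_det T).mp hT
  have hH : (T⁻¹ᴴ * A * T⁻¹).IsHermitian := isHermitian_conjTranspose_mul_mul _ hA
  set U : Matrix ι ι ℂ := (hH.eigenvectorUnitary : Matrix ι ι ℂ) with hU
  have hUU : Uᴴ * U = 1 := Unitary.coe_star_mul_self hH.eigenvectorUnitary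
  refine ⟨T⁻¹ * U, hH.eigenvalues, ?_, ?_⟩
  · have h := hH.conjStarAlgAut_star_eigenvectorUnitary
    rw [Unitary.conjStarAlgAut_star_apply, ← hU, star_eq_conjTranspose] at h
    refine Eq.trans ?_ h
    rw [conjTranspose_mul]
    simp only [Matrix.mul_assoc]
  · have h1 : T⁻¹ᴴ * Tᴴ = 1 := by
      rw [← conjTranspose_mul, mul_nonsing_inv _ hT', conjTranspose_one]
    calc (T⁻¹ * U)ᴴ * S * (T⁻¹ * U)
        = Uᴴ * ((T⁻¹ᴴ * Tᴴ) * (T * T⁻¹)) * U := by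
          rw [hST, conjTranspose_mul]; simp only [Matrix.mul_assoc]
      _ = 1 := by rw [h1, mul_nonsing_inv _ hT', Matrix.mul_one, Matrix.mul_one, hUU]

theorem exists_antitone_simultaneous_diagonal {n : ℕ} {A S : Matrix (Fin n) (Fin n) ℂ}
    (hA : A.PosDef) (hS : S.PosDef) :
    ∃ (P : Matrix (Fin n) (Fin n) ℂ) (d : Fin n → ℝ), Antitone d ∧ (∀ j, 0 < d j) ∧ IsUnit P ∧
      Pᴴ * A * P = diagonal (fun j => (d j : ℂ)) ∧ Pᴴ * S * P = 1 := by
  obtain ⟨P, d, hPA, hPS⟩ := exists_simultaneous_diagonal hA.1 hS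
  set σ : Equiv.Perm (Fin n) := Tuple.sort fun j => -d j with hσ
  have hsub : ∀ M : Matrix (Fin n) (Fin n) ℂ,
      (P.submatrix id σ)ᴴ * M * P.submatrix id σ = (Pᴴ * M * P).submatrix σ σ := by
    intro M
    ext a b
    simp [Matrix.mul_apply]
  have hS1 : (P.submatrix id σ)ᴴ * S * P.submatrix id σ = 1 := by
    rw [hsub, hPS, submatrix_one_equiv]
  have hA1 : (P.submatrix id σ)ᴴ * A * P.submatrix id σ =
      diagonal (fun j => (d (σ j) : ℂ)) := by
    rw [hsub, hPA, submatrix_diagonal_equiv]; rfl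
  have hunit : IsUnit (P.submatrix id σ) := IsUnit.of_mul_eq_one_right _ hS1
  refine ⟨P.submatrix id σ, d ∘ σ, ?_, ?_, hunit, hA1, hS1⟩
  · have := Tuple.monotone_sort fun j => -d j
    intro a b hab
    simpa using this hab
  · have := hA.conjTranspose_mul_mul_same (mulVec_injective_of_isUnit hunit)
    rw [hA1, posDef_diagonal_iff] at this
    intro j
    exact_mod_cast this j

/-- Congruence by `P` only multiplies the pencil determinant by a nonzero constant, so roots and
multiplicities can be read off the diagonal pencil. -/
theorem roots_gsvPoly {m₁ m₂ n : Type*} [Fintype m₁] [Fintype m₂] [Fintype n] [DecidableEq n]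
    {A₁ : Matrix m₁ n ℂ} {A₂ : Matrix m₂ n ℂ} {P : Matrix n n ℂ} {d : n → ℝ} (hP : IsUnit P)
    (h₁ : Pᴴ * (A₁ᴴ * A₁) * P = diagonal (fun j => (d j : ℂ))) (h₂ : Pᴴ * (A₂ᴴ * A₂) * P = 1) :
    (gsvPoly A₁ A₂).roots = Finset.univ.val.map fun j => (d j : ℂ) := by
  have hdet : P.det ≠ 0 := ((isUnit_iff_isUnit_det P).mp hP).ne_zero
  have hdet' : Pᴴ.det ≠ 0 := by rw [det_conjTranspose]; exact star_ne_zero.mpr hdet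
  have key : C Pᴴ.det * gsvPoly A₁ A₂ * C P.det = C ((-1) ^ Fintype.card n) *
      ∏ j, (X - C (d j : ℂ)) := by
    have e : ∀ M : Matrix n n ℂ, C M.det = (M.map C).det := fun M => RingHom.map_det C M
    have hm : ∀ M N : Matrix n n ℂ, (M * N).map C = M.map C * N.map C := fun M N =>
      Matrix.map_mul (f := (C : ℂ →+* ℂ[X]))
    rw [e, e, gsvPoly, ← det_mul, ← det_mul, Matrix.mul_sub, Matrix.sub_mul, Matrix.mul_smul,
      Matrix.smul_mul, ← hm, ← hm, ← hm, ← hm, h₁, h₂]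
    have : (diagonal fun j => (d j : ℂ)).map C - (X : ℂ[X]) • (1 : Matrix n n ℂ).map C =
        diagonal fun j => C (-1) * (X - C (d j : ℂ)) := by
      rw [Matrix.map_one _ (map_zero C) (map_one C), diagonal_map (map_zero C),
        smul_one_eq_diagonal, diagonal_sub]
      congr 1; ext1 j; simp
    rw [this, det_diagonal, Finset.prod_mul_distrib]
    simp
  have hr := congrArg Polynomial.roots key
  rw [mul_assoc, roots_C_mul _ hdet', mul_comm, roots_C_mul _ hdet,
    roots_C_mul _ (by simp), roots_prod _ _
      (Finset.prod_ne_zero_iff.mpr fun j _ => X_sub_C_ne_zero _)] at hr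
  simpa using hr

theorem gsv_eq_sqrt {m₁ m₂ : Type*} {n : ℕ} [Fintype m₁] [Fintype m₂]
    {A₁ : Matrix m₁ (Fin n) ℂ} {A₂ : Matrix m₂ (Fin n) ℂ} {P : Matrix (Fin n) (Fin n) ℂ}
    {d : Fin n → ℝ} (hd : Antitone d) (hpos : ∀ j, 0 < d j) (hP : IsUnit P)
    (h₁ : Pᴴ * (A₁ᴴ * A₁) * P = diagonal (fun j => (d j : ℂ))) (h₂ : Pᴴ * (A₂ᴴ * A₂) * P = 1)
    (i : Fin n) : gsv A₁ A₂ i = √(d i) := by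
  classical
  have hms : gsvMultiset A₁ A₂ = (List.ofFn fun j => √(d j) : List ℝ) := by
    rw [gsvMultiset, roots_gsvPoly hP h₁ h₂, Multiset.filter_eq_self.mpr, Multiset.map_map,
      Fin.univ_val_map]
    · rfl
    · intro z hz
      obtain ⟨j, -, rfl⟩ := Multiset.mem_map.mp hz
      simp [(hpos j).le]
  have hs : (gsvMultiset A₁ A₂).sort (· ≥ ·) = List.ofFn fun j => √(d j) := by
    rw [hms, Multiset.coe_sort]
    apply List.mergeSort_of_pairwise
    simp_rw [decide_eq_true_eq, ← List.sortedGE_iff_pairwise]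
    exact Antitone.sortedGE_ofFn fun a b hab => Real.sqrt_le_sqrt (hd hab)
  rw [gsv, hs]
  simp

/-! ### Inertia comparison and contractions -/

/-- A dimension count: two coordinate subspaces of complementary excess, transported by invertible
matrices, intersect, so a quadratic form that is nonnegative on the first cannot be carried to one
that is negative definite on the second. -/
theorem card_add_card_le_of_form {n : ℕ} {P P' C : Matrix (Fin n) (Fin n) ℂ}
    (hP : IsUnit P) (hP' : IsUnit P') (q q' : (Fin n → ℂ) → ℝ) (e e' : Fin n → ℝ)
    (hq : ∀ x, q (P *ᵥ x) = ∑ j, e j * Complex.normSq (x j))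
    (hq' : ∀ x, q' (P' *ᵥ x) = ∑ j, e' j * Complex.normSq (x j))
    (hC : ∀ v, v ≠ 0 → 0 ≤ q v → C *ᵥ v ≠ 0 ∧ 0 ≤ q' (C *ᵥ v))
    {s t : Finset (Fin n)} (hs : ∀ j ∈ s, 0 ≤ e j) (ht : ∀ j ∈ t, e' j < 0) :
    s.card + t.card ≤ n := by
  by_contra! hlt
  let ext (u : Finset (Fin n)) : (u → ℂ) →ₗ[ℂ] (Fin n → ℂ) :=
    Function.ExtendByZero.linearMap ℂ Subtype.val
  have hmem : ∀ (u : Finset (Fin n)) (x : u → ℂ) (j : u), ext u x j = x j := fun u x j =>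
    Subtype.val_injective.extend_apply x (0 : Fin n → ℂ) j
  have hnot : ∀ (u : Finset (Fin n)) (x : u → ℂ) (j), j ∉ u → ext u x j = 0 := fun u x j hj =>
    Function.extend_apply' x (0 : Fin n → ℂ) j (by rintro ⟨a, rfl⟩; exact hj a.2)
  have hext : ∀ (u : Finset (Fin n)) (x : u → ℂ), ext u x = 0 → x = 0 := fun u x h => by
    ext1 j; rw [← hmem u x j, h]; rfl
  -- A kernel element is a pair with `C P x = P' y`; one is nonzero because the domain has dimension
  -- `s.card + t.card > n`.
  let L : (s → ℂ) × (t → ℂ) →ₗ[ℂ] (Fin n → ℂ) :=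
    ((C * P).mulVecLin ∘ₗ ext s).coprod (-(P'.mulVecLin ∘ₗ ext t))
  have hker : L.ker ≠ ⊥ := by
    apply LinearMap.ker_ne_bot_of_finrank_lt
    simpa [Module.finrank_prod] using hlt
  obtain ⟨⟨x, y⟩, hxy, hne⟩ := (Submodule.ne_bot_iff _).mp hker
  have hL : C *ᵥ (P *ᵥ ext s x) = P' *ᵥ ext t y := by
    have : (C * P) *ᵥ ext s x + -(P' *ᵥ ext t y) = 0 := hxy
    rw [mulVec_mulVec]
    exact add_neg_eq_zero.mp this
  have hinj := mulVec_injective_of_isUnit hP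
  have hinj' := mulVec_injective_of_isUnit hP'
  by_cases hx : x = 0
  · subst hx
    rw [map_zero, mulVec_zero, mulVec_zero] at hL
    have : ext t y = 0 := hinj' (by rw [← hL, mulVec_zero])
    exact hne (by rw [hext t y this]; rfl)
  · have hv : P *ᵥ ext s x ≠ 0 := fun h =>
      hx (hext s x (hinj (h.trans (mulVec_zero P).symm)))
    have hqv : 0 ≤ q (P *ᵥ ext s x) := by
      rw [hq]
      refine Finset.sum_nonneg fun j _ => ?_
      by_cases hj : j ∈ s
      · exact mul_nonneg (hs j hj) (Complex.normSq_nonneg _)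
      · simp [hnot s x j hj]
    obtain ⟨hw, hqw⟩ := hC _ hv hqv
    rw [hL] at hw hqw
    rw [hq'] at hqw
    have hy : y ≠ 0 := by
      rintro rfl
      exact hw (by rw [map_zero, mulVec_zero])
    obtain ⟨k, hk⟩ := Function.ne_iff.mp hy
    refine hqw.not_gt (Finset.sum_neg' (fun j _ => ?_) ⟨k, Finset.mem_univ _, ?_⟩)
    · by_cases hj : j ∈ t
      · exact mul_nonpos_of_nonpos_of_nonneg (ht j hj).le (Complex.normSq_nonneg _)
      · simp [hnot t y j hj]
    · rw [hmem]
      exact mul_neg_of_neg_of_pos (ht k k.2) (Complex.normSq_pos.mpr hk)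

/-- **Douglas' lemma**: if `B Bᴴ ≼ B' B'ᴴ`, then `B` factors through `B'` by a contraction. -/
theorem exists_contraction_of_posSemidef_sub {ι : Type*} [Fintype ι] [DecidableEq ι]
    {B B' : Matrix ι ι ℂ} (h : (B' * B'ᴴ - B * Bᴴ).PosSemidef) :
    ∃ C : Matrix ι ι ℂ, B = B' * C ∧ ∀ v, sqNorm (C *ᵥ v) ≤ sqNorm v := by
  let E := EuclideanSpace ℂ ι
  let Φ := toEuclideanCLM (n := ι) (𝕜 := ℂ)
  let f : E →ₗ[ℂ] E := (Φ B'ᴴ : E →L[ℂ] E)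
  let g : E →ₗ[ℂ] E := (Φ Bᴴ : E →L[ℂ] E)
  have hgf : ∀ x, ‖g x‖ ≤ ‖f x‖ := by
    intro x
    have h1 := h.dotProduct_mulVec_nonneg x.ofLp
    have e : ∀ M : Matrix ι ι ℂ, star x.ofLp ⬝ᵥ ((M * Mᴴ) *ᵥ x.ofLp) =
        ((‖(Φ Mᴴ : E →L[ℂ] E) x‖ ^ 2 : ℝ) : ℂ) := by
      intro M
      have := ofReal_sqNorm_mulVec Mᴴ x.ofLp
      rw [conjTranspose_conjTranspose] at this
      rw [← this, sqNorm_eq_norm_sq]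
      rfl
    rw [sub_mulVec, dotProduct_sub, e, e, ← Complex.ofReal_sub] at h1
    have h2 : 0 ≤ ‖f x‖ ^ 2 - ‖g x‖ ^ 2 := by exact_mod_cast h1
    exact (sq_le_sq₀ (norm_nonneg _) (norm_nonneg _)).mp (by linarith)
  obtain ⟨r, hr⟩ := f.rangeRestrict.exists_rightInverse_of_surjective f.range_rangeRestrict
  have hr' : ∀ z : f.range, f (r z) = z := fun z => congrArg Subtype.val (LinearMap.congr_fun hr z)
  -- `Z` sends `f x` to `g x` and vanishes on the orthogonal complement of the range of `f`; the
  -- contraction sought is its adjoint.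
  let Z : E →L[ℂ] E := LinearMap.toContinuousLinearMap
    (g ∘ₗ r ∘ₗ (f.range.orthogonalProjectionOnto : E →ₗ[ℂ] f.range))
  have hZ : ∀ u, Z u = g (r (f.range.orthogonalProjectionOnto u)) := fun u => rfl
  have hZf : ∀ x, Z (f x) = g x := by
    intro x
    have hp : f.range.orthogonalProjectionOnto (f x) = ⟨f x, LinearMap.mem_range_self f x⟩ :=
      Submodule.orthogonalProjectionOnto_mem_subspace_eq_self
        (⟨f x, LinearMap.mem_range_self f x⟩ : f.range)
    -- The chosen preimage of `f x` differs from `x` by an element of `ker f`, which `hgf` places in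
    -- `ker g`.
    rw [hZ, hp, ← sub_eq_zero, ← map_sub, ← norm_le_zero_iff]
    refine (hgf _).trans ?_
    rw [map_sub, hr', sub_self, norm_zero]
  have hZn : ‖Z‖ ≤ 1 := by
    refine Z.opNorm_le_bound zero_le_one fun u => ?_
    rw [hZ, one_mul]
    refine (hgf _).trans ?_
    rw [hr']
    exact f.range.norm_orthogonalProjectionOnto_apply_le u
  have hmul : Φ.symm Z * B'ᴴ = Bᴴ := by
    apply Φ.injective
    change Φ (Φ.symm Z * B'ᴴ) = Φ Bᴴ
    rw [map_mul Φ, StarAlgEquiv.apply_symm_apply]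
    ext1 x
    exact hZf x
  refine ⟨(Φ.symm Z)ᴴ, ?_, fun v => ?_⟩
  · have := congrArg conjTranspose hmul
    rw [conjTranspose_mul, conjTranspose_conjTranspose, conjTranspose_conjTranspose] at this
    exact this.symm
  · rw [sqNorm_eq_norm_sq, sqNorm_eq_norm_sq]
    have e : WithLp.toLp 2 ((Φ.symm Z)ᴴ *ᵥ v) = (star Z) (WithLp.toLp 2 v) := by
      have : Φ (Φ.symm Z)ᴴ = star Z := by
        rw [← star_eq_conjTranspose, map_star, StarAlgEquiv.apply_symm_apply]
      rw [← this]
      rfl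
    rw [e]
    refine pow_le_pow_left₀ (norm_nonneg _) ?_ 2
    refine ((star Z).le_of_opNorm_le (by
      rwa [ContinuousLinearMap.star_eq_adjoint, LinearIsometryEquiv.norm_map]) _).trans_eq (one_mul _)

theorem sqNorm_effMMSE {m n : Type*} [Fintype m] [Fintype n] [DecidableEq n]
    (H : Matrix m n ℂ) (B : Matrix n n ℂ) (v : n → ℂ) :
    sqNorm (effMMSE H B *ᵥ v) = sqNorm (H *ᵥ (B *ᵥ v)) + sqNorm v := by
  simp [sqNorm, effMMSE, fromRows_mulVec, Fintype.sum_sum_type, mulVec_mulVec]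

theorem posDef_effMMSE {m n : Type*} [Fintype m] [Fintype n] [DecidableEq n]
    (H : Matrix m n ℂ) (B : Matrix n n ℂ) : ((effMMSE H B)ᴴ * effMMSE H B).PosDef := by
  refine .conjTranspose_mul_self _ fun v w h => ?_
  have := congrArg (fun z => z ∘ Sum.inr) h
  simpa [effMMSE, fromRows_mulVec] using this

/-- The contraction `C` with `B = B' C` preserves nonnegativity of the pencil form. -/
theorem channel_form_mono {mB mE n : Type*} [Fintype mB] [Fintype mE] [Fintype n] [DecidableEq n]
    (HB : Matrix mB n ℂ) (HE : Matrix mE n ℂ) {B B' C : Matrix n n ℂ} (hBC : B = B' * C)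
    (hC : ∀ v, sqNorm (C *ᵥ v) ≤ sqNorm v) {a b : ℝ} (hab : a < b) {v : n → ℂ} (hv : v ≠ 0)
    (h : 0 ≤ a * sqNorm (effMMSE HB B *ᵥ v) - b * sqNorm (effMMSE HE B *ᵥ v)) :
    C *ᵥ v ≠ 0 ∧ 0 ≤ a * sqNorm (effMMSE HB B' *ᵥ (C *ᵥ v)) -
      b * sqNorm (effMMSE HE B' *ᵥ (C *ᵥ v)) := by
  have hBv : B *ᵥ v = B' *ᵥ (C *ᵥ v) := by rw [hBC, mulVec_mulVec]
  simp only [sqNorm_effMMSE, hBv] at h ⊢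
  have hv0 := sqNorm_pos hv
  refine ⟨fun h0 => ?_, by nlinarith [hC v]⟩
  -- If `C v = 0`, the form at `v` is `-(b - a)‖v‖² < 0`.
  simp only [h0, mulVec_zero, sqNorm_zero] at h
  nlinarith

theorem lemma1 {nA nB nE : ℕ}
    (HB : Matrix (Fin nB) (Fin nA) ℂ) (HE : Matrix (Fin nE) (Fin nA) ℂ)
    (K K' : Matrix (Fin nA) (Fin nA) ℂ)
    (hK : K.PosSemidef) (hKK' : (K' - K).PosSemidef)
    (B B' : Matrix (Fin nA) (Fin nA) ℂ) (hB : IsMatrixSqrt B K) (hB' : IsMatrixSqrt B' K')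
    (i : Fin nA) :
    0 < channelGSV HB HE B i ∧ 0 < channelGSV HB HE B' i ∧
      |Real.log (channelGSV HB HE B i)| ≤ |Real.log (channelGSV HB HE B' i)| ∧
      (1 ≤ channelGSV HB HE B' i →
        1 ≤ channelGSV HB HE B i ∧ channelGSV HB HE B i ≤ channelGSV HB HE B' i) ∧
      (channelGSV HB HE B' i ≤ 1 →
        channelGSV HB HE B' i ≤ channelGSV HB HE B i ∧ channelGSV HB HE B i ≤ 1) := by
  rw [IsMatrixSqrt] at hB hB'
  rw [← hB, ← hB'] at hKK'
  obtain ⟨C, hBC, hC⟩ := exists_contraction_of_posSemidef_sub hKK'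
  obtain ⟨P, d, hd, hpos, hP, h₁, h₂⟩ := exists_antitone_simultaneous_diagonal
    (posDef_effMMSE HB B) (posDef_effMMSE HE B)
  obtain ⟨P', d', hd', hpos', hP', h₁', h₂'⟩ := exists_antitone_simultaneous_diagonal
    (posDef_effMMSE HB B') (posDef_effMMSE HE B')
  have hg : channelGSV HB HE B i = √(d i) := gsv_eq_sqrt hd hpos hP h₁ h₂ i
  have hg' : channelGSV HB HE B' i = √(d' i) := gsv_eq_sqrt hd' hpos' hP' h₁' h₂' i
  have one_diag : (1 : Matrix (Fin nA) (Fin nA) ℂ) = diagonal fun _ => ((1 : ℝ) : ℂ) := by simp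
  rw [one_diag] at h₂ h₂'
  have hform : ∀ (a b : ℝ) (x : Fin nA → ℂ), a * sqNorm (effMMSE HB B *ᵥ (P *ᵥ x)) -
      b * sqNorm (effMMSE HE B *ᵥ (P *ᵥ x)) = ∑ j, (a * d j - b) * Complex.normSq (x j) := by
    intro a b x
    rw [sqNorm_mulVec_of_diagonal h₁, sqNorm_mulVec_of_diagonal h₂, Finset.mul_sum,
      Finset.mul_sum, ← Finset.sum_sub_distrib]
    exact Finset.sum_congr rfl fun j _ => by ring
  have hform' : ∀ (a b : ℝ) (x : Fin nA → ℂ), a * sqNorm (effMMSE HB B' *ᵥ (P' *ᵥ x)) -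
      b * sqNorm (effMMSE HE B' *ᵥ (P' *ᵥ x)) = ∑ j, (a * d' j - b) * Complex.normSq (x j) := by
    intro a b x
    rw [sqNorm_mulVec_of_diagonal h₁', sqNorm_mulVec_of_diagonal h₂', Finset.mul_sum,
      Finset.mul_sum, ← Finset.sum_sub_distrib]
    exact Finset.sum_congr rfl fun j _ => by ring
  have hcount : ∀ (a b : ℝ), a < b → ∀ s t : Finset (Fin nA), (∀ j ∈ s, 0 ≤ a * d j - b) →
      (∀ j ∈ t, a * d' j - b < 0) → s.card + t.card ≤ nA := fun a b hab s t hs ht =>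
    card_add_card_le_of_form hP hP'
      (fun v => a * sqNorm (effMMSE HB B *ᵥ v) - b * sqNorm (effMMSE HE B *ᵥ v))
      (fun v => a * sqNorm (effMMSE HB B' *ᵥ v) - b * sqNorm (effMMSE HE B' *ᵥ v))
      _ _ (hform a b) (hform' a b)
      (fun v hv h => channel_form_mono HB HE hBC hC hab hv h) hs ht
  -- The intervals share `i`, so the total exceeds the bound of `hcount` by one.
  have hcard : (Finset.Iic i).card + (Finset.Ici i).card = nA + 1 := by
    rw [Fin.card_Iic, Fin.card_Ici]; omega
  have up : 1 < d i → d i ≤ d' i := by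
    intro h
    by_contra! hlt
    have := hcount 1 (d i) h (Finset.Iic i) (Finset.Ici i)
      (fun j hj => by linarith [hd (Finset.mem_Iic.mp hj)])
      (fun j hj => by linarith [hd' (Finset.mem_Ici.mp hj)])
    omega
  have down : d i < 1 → d' i ≤ d i := by
    intro h
    by_contra! hlt
    -- Negating the form exchanges the two intervals, and `a < b` becomes `d i < 1`.
    have := hcount (-1) (-d i) (by linarith) (Finset.Ici i) (Finset.Iic i)
      (fun j hj => by linarith [hd (Finset.mem_Ici.mp hj)])
      (fun j hj => by linarith [hd' (Finset.mem_Iic.mp hj)])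
    omega
  have h0 := Real.sqrt_pos.mpr (hpos i)
  have h0' := Real.sqrt_pos.mpr (hpos' i)
  rw [hg, hg']
  have up' : 1 < √(d i) → √(d i) ≤ √(d' i) := fun h =>
    Real.sqrt_le_sqrt (up (by simpa using (Real.lt_sqrt zero_le_one).mp h))
  have down' : √(d i) < 1 → √(d' i) ≤ √(d i) := fun h =>
    Real.sqrt_le_sqrt (down (by simpa using (Real.sqrt_lt' one_pos).mp h))
  generalize √(d i) = x at *
  generalize √(d' i) = y at *
  refine ⟨h0, h0', ?_, fun hy => ?_, fun hy => ?_⟩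
  -- At `x = 1` neither `up'` nor `down'` applies, but there `log x = 0`.
  · rcases lt_trichotomy x 1 with h | rfl | h
    · have hl := Real.log_le_log h0' (down' h)
      have := Real.log_neg h0 h
      rw [abs_of_neg this, abs_of_neg (by linarith)]
      linarith
    · simp
    · have hl := Real.log_le_log h0 (up' h)
      have := Real.log_pos h
      rw [abs_of_pos this, abs_of_pos (by linarith)]
      exact hl
  · rcases lt_trichotomy x 1 with h | rfl | h
    · exact absurd (down' h) (by linarith)
    · exact ⟨le_rfl, hy⟩
    · exact ⟨h.le, up' h⟩
  · rcases lt_trichotomy x 1 with h | rfl | h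
    · exact ⟨down' h, h.le⟩
    · exact ⟨hy, le_rfl⟩
    · exact absurd (up' h) (by linarith)
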